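/- Let $C>0$ and let $f:\mathbb R\to\mathbb R$ be a differentiable link function such that, for $|x|\le C^2$, $0<f(x)<1$ and $f'(x)\neq 0$, and $$\sup_{|x|\le C^2}\frac{|f'(x)|}{f(x)(1-f(x))}<\infty,\qquad \sup_{|x|\le C^2}\frac{f(x)(1-f(x))}{(f'(x))^2}<\infty .$$ For $N,J\ge 1$ and $K\ge 0$, parameters are triples $(\Theta,A,\mathbf d)$, where $\Theta\in\mathbb R^{N\times K}$ has rows $\boldsymbol\theta_i^\top$, $A\in\mathbb R^{J\times K}$ has rows $\mathbf a_j^\top$, and $\mathbf d\in\mathbb R^J$. Call $(\Theta,A,\mathbf d)$ feasible if $\sqrt{1+\|\boldsymbol\theta_i\|^2}\le C$ for all $i\le N$ and $\sqrt{d_j^2+\|\mathbf a_j\|^2}\le C$ for all $j\le J$ (Euclidean norms). For responses $y\in\{0,1\}^{N\times J}$, a constrained joint maximum likelihood estimate (CJMLE) is any maximizer, over the feasible triples, of $\log L$, where $$L(\Theta,A,\mathbf d)=\prod_{i=1}^N\prod_{j=1}^J f(d_j+\mathbf a_j^\top\boldsymbol\theta_i)^{y_{ij}}\bigl(1-f(d_j+\mathbf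 a_j^\top\boldsymbol\theta_i)\bigr)^{1-y_{ij}} .$$ Then there are constants $C_1,C_2>0$, depending only on $C$ and the given link $f$ (in particular not on $N$, $J$, $K$ or the true parameters), such that the following holds for all $N,J\ge1$, all $K$, and every feasible true parameter $(\Theta^*,A^*,\mathbf d^*)$. If $Y_{ij}$ ($i\le N$, $j\le J$) are independent $\{0,1\}$-valued random variables with $P(Y_{ij}=1)=f(d_j^*+(\mathbf a_j^*)^\top\boldsymbol\theta_i^*)$, then a CJMLE exists for every $y\in\{0,1\}^{N\times J}$, and with probability at least $1-C_1/(N+J)$ every CJMLE $(\hat\Theta,\hat A,\hat{\mathbf d})$ computed from $(Y_{ij})$ satisfies $$\frac1{NJ}\bigl\|\hat\Theta\hat A^\top+\mathbf 1_N\hat{\mathbf d}^\top-\Theta^*(A^*)^\top-\mathbf 1_N(\mathbf d^*)^\top\bigr\|_F^2\le C_2\sqrt{\frac{J+N}{NJ}},$$ where $\|\cdot\|_F$ is the Frobenius norm and $\mathbf 1_N$ is the all-ones vector in $\mathbb R^N$. -/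

import Mathlib

/-- The parameters of an item factor analysis model with `N` respondents, `J` items and `K` latent
factors: person parameters `Θ` (row `i` is `θ_i`), loadings `A` (row `j` is `a_j`) and
intercepts `d`. -/
structure IFAParams (N J K : ℕ) where
  Θ : Matrix (Fin N) (Fin K) ℝ
  A : Matrix (Fin J) (Fin K) ℝ
  d : Fin J → ℝ

/-- The matrix `Θ Aᵀ + 1_N dᵀ`, whose `(i, j)` entry is `d_j + a_jᵀ θ_i`. -/
noncomputable def IFAParams.predictor {N J K : ℕ} (ψ : IFAParams N J K) :
    Matrix (Fin N) (Fin J) ℝ :=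
  ψ.Θ * ψ.A.transpose + Matrix.vecMulVec (fun _ => 1) ψ.d

/-- The constraint set `√(1 + ‖θ_i‖²) ≤ C`, `√(d_j² + ‖a_j‖²) ≤ C` for all `i`, `j`
(Euclidean norms). -/
def feasibleSet (N J K : ℕ) (C : ℝ) : Set (IFAParams N J K) :=
  {ψ | (∀ i, √(1 + ‖WithLp.toLp 2 (ψ.Θ i)‖ ^ 2) ≤ C) ∧
       (∀ j, √((ψ.d j) ^ 2 + ‖WithLp.toLp 2 (ψ.A j)‖ ^ 2) ≤ C)}

/-- The joint likelihood of the dichotomous responses `y`. -/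
noncomputable def jointLik {N J K : ℕ} (f : ℝ → ℝ) (y : Fin N → Fin J → Fin 2)
    (ψ : IFAParams N J K) : ℝ :=
  ∏ i, ∏ j, f (ψ.predictor i j) ^ (y i j : ℕ) * (1 - f (ψ.predictor i j)) ^ (1 - (y i j : ℕ))

/-- `ψ` is a constrained joint maximum likelihood estimate for the responses `y`: a maximizer of
the joint log-likelihood over the constraint set. Maximizers are not unique in general. -/
def IsCJMLE {N J K : ℕ} (f : ℝ → ℝ) (C : ℝ) (y : Fin N → Fin J → Fin 2)
    (ψ : IFAParams N J K) : Prop :=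
  ψ ∈ feasibleSet N J K C ∧
    IsMaxOn (fun ψ' => Real.log (jointLik f y ψ')) (feasibleSet N J K C) ψ

/-- Regularity of the link function: `f` is differentiable and both
`|f'| / (f (1 - f))` and `f (1 - f) / (f')²` have a finite supremum over `|x| ≤ C²`.
Finiteness of the suprema includes that the denominators do not vanish there (division by zero
is not to be read as zero), where `f (x)` is a probability. -/
structure LinkRegular (f : ℝ → ℝ) (C : ℝ) : Prop where
  differentiable : Differentiable ℝ f
  pos : ∀ x, |x| ≤ C ^ 2 → 0 < f x
  lt_one : ∀ x, |x| ≤ C ^ 2 → f x < 1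
  deriv_ne_zero : ∀ x, |x| ≤ C ^ 2 → deriv f x ≠ 0
  bdd_score : BddAbove ((fun x => |deriv f x| / (f x * (1 - f x))) '' {x | |x| ≤ C ^ 2})
  bdd_inv_info : BddAbove ((fun x => f x * (1 - f x) / (deriv f x) ^ 2) '' {x | |x| ≤ C ^ 2})

/-- The responses `Y i j` follow the model with link `f` and parameters `ψ`: they are independent
`{0, 1}`-valued random variables with `P (Y i j = 1) = f (d_j + a_jᵀ θ_i)`. -/
structure IsIFAModel {N J K : ℕ} {Ω : Type*} [MeasurableSpace Ω] (P : MeasureTheory.Measure Ω)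
    (f : ℝ → ℝ) (ψ : IFAParams N J K) (Y : Fin N → Fin J → Ω → Fin 2) : Prop where
  measurable : ∀ i j, Measurable (Y i j)
  prob_one : ∀ i j, P.real {ω | Y i j ω = 1} = f (ψ.predictor i j)
  indep : ProbabilityTheory.iIndepFun (fun p : Fin N × Fin J => Y p.1 p.2) P

/-- The Frobenius norm of a matrix. -/
noncomputable def frobNorm {N J : ℕ} (X : Matrix (Fin N) (Fin J) ℝ) : ℝ :=
  √(∑ i, ∑ j, X i j ^ 2)

/-!
A constrained maximum likelihood estimate has at least the likelihood of the true parameter, so the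
total Kullback–Leibler divergence between the Bernoulli laws of the true and the estimated
parameter is at most the centred log-likelihood ratio at the estimate. Regularity of the link bounds
the divergence below by a multiple of the squared Frobenius distance of the predictors. To bound
the centred log-likelihood ratio uniformly over the feasible set, symmetrization and the contraction
principle replace the log-odds, which are `L`-Lipschitz in the predictor, by `L` times the predictor
with Rademacher signs. Trace duality for the factorization of the predictor, whose factors have rows
of length at most `C`, leaves at most `2 L C² √(N J)` times the operator norm of an `N × J` sign
matrix. Its moment generating function is controlled by finite norming sets with at most `5 ^ N` and
`5 ^ J` points, and the Chernoff bound shows that the ratio is `O (√(N J (N + J)))` outside an event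
of probability at most `1 / (N + J)`.
-/

section Contraction

theorem convexOn_add_le_add_of_le_max {φ : ℝ → ℝ} (hφ : ConvexOn ℝ Set.univ φ)
    (hmono : Monotone φ) {x y a b : ℝ} (hsum : x + y ≤ a + b) (hx : x ≤ max a b)
    (hy : y ≤ max a b) :
    φ x + φ y ≤ φ a + φ b := by
  wlog hab : b ≤ a generalizing a b
  · rw [add_comm (φ a)]
    exact this (by rwa [add_comm b]) (by rwa [max_comm]) (by rwa [max_comm]) (le_of_not_ge hab)
  rw [max_eq_left hab] at hx hy
  rcases le_total x b with hxb | hbx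
  · linarith [hmono hxb, hmono hy]
  · obtain ⟨s, t, hs, ht, hst, rfl⟩ := Icc_subset_segment ⟨hbx, hx⟩
    simp only [smul_eq_mul] at hsum ⊢
    have hy' : y ≤ t * b + s * a := by
      linear_combination hsum - (a + b) * hst
    have h₁ := hφ.2 (Set.mem_univ b) (Set.mem_univ a) hs ht hst
    have h₂ := hφ.2 (Set.mem_univ b) (Set.mem_univ a) ht hs (by rw [add_comm, hst])
    simp only [smul_eq_mul] at h₁ h₂
    linear_combination h₁ + h₂ + hmono hy' + (φ a + φ b) * hst

variable {α : Type*} [Finite α] [Nonempty α] {φ : ℝ → ℝ}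

theorem add_iSup_le_add_iSup_of_contraction (hφ : ConvexOn ℝ Set.univ φ) (hmono : Monotone φ)
    (a : α → ℝ) {g b : α → ℝ} (hgb : ∀ t, |g t| ≤ |b t|)
    (hgb' : ∀ s t, |g s - g t| ≤ |b s - b t|) :
    φ (⨆ t, a t + g t) + φ (⨆ t, a t - g t) ≤ φ (⨆ t, a t + b t) + φ (⨆ t, a t - b t) := by
  obtain ⟨s, hs⟩ := exists_eq_ciSup_of_finite (f := fun t => a t + g t)
  obtain ⟨t, ht⟩ := exists_eq_ciSup_of_finite (f := fun t => a t - g t)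
  rw [← hs, ← ht]
  have hadd := le_ciSup (Finite.bddAbove_range fun t => a t + b t)
  have hsub := le_ciSup (Finite.bddAbove_range fun t => a t - b t)
  have abs_le_max (u : α) : a u + |g u| ≤ max (⨆ t, a t + b t) (⨆ t, a t - b t) := by
    rw [le_max_iff]
    rcases abs_cases (b u) with h | h
    · left; linarith [hadd u, hgb u]
    · right; linarith [hsub u, hgb u]
  refine convexOn_add_le_add_of_le_max hφ hmono ?_ ?_ ?_
  · have := (le_abs_self _).trans (hgb' s t)
    rcases abs_cases (b s - b t) with h | h
    · linarith [hadd s, hsub t]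
    · linarith [hadd t, hsub s]
  · linarith [abs_le_max s, le_abs_self (g s)]
  · linarith [abs_le_max t, neg_le_abs (g t)]

theorem iSup_add_mul_le (hφ : ConvexOn ℝ Set.univ φ) (hmono : Monotone φ) (a g : α → ℝ) {x : ℝ}
    (hx : |x| ≤ 1) :
    φ (⨆ t, a t + x * g t) ≤
      (1 + x) / 2 * φ (⨆ t, a t + g t) + (1 - x) / 2 * φ (⨆ t, a t - g t) := by
  obtain ⟨hx₀, hx₁⟩ := abs_le.1 hx
  have hpos : 0 ≤ (1 + x) / 2 := by linarith
  have hneg : 0 ≤ (1 - x) / 2 := by linarith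
  refine (hmono (ciSup_le fun t => ?_)).trans
    (hφ.2 (Set.mem_univ _) (Set.mem_univ _) hpos hneg (by ring))
  have h₁ := mul_le_mul_of_nonneg_left
    (le_ciSup (Finite.bddAbove_range fun t => a t + g t) t) hpos
  have h₂ := mul_le_mul_of_nonneg_left
    (le_ciSup (Finite.bddAbove_range fun t => a t - g t) t) hneg
  simp only [smul_eq_mul]
  linarith

theorem bernoulli_iSup_le_rademacher (hφ : ConvexOn ℝ Set.univ φ) (hmono : Monotone φ)
    (a g : α → ℝ) {p : ℝ} (hp : p ∈ Set.Icc 0 1) :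
    (1 - p) * φ (⨆ t, a t + (0 - p) * g t) + p * φ (⨆ t, a t + (1 - p) * g t) ≤
      (φ (⨆ t, a t + g t) + φ (⨆ t, a t - g t)) / 2 := by
  obtain ⟨hp₀, hp₁⟩ := hp
  have h₀ := iSup_add_mul_le hφ hmono a g (x := 0 - p) (abs_le.2 ⟨by linarith, by linarith⟩)
  have h₁ := iSup_add_mul_le hφ hmono a g (x := 1 - p) (abs_le.2 ⟨by linarith, by linarith⟩)
  linear_combination (1 - p) * h₀ + p * h₁

end Contraction

section BernoulliExpect

/-- The probability of the outcome `x` of a `{0, 1}`-valued variable with success probability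
`p`. -/
def bernoulliWeight (p : ℝ) (x : Fin 2) : ℝ := if x = 1 then p else 1 - p

/-- The expectation functional of a vector of independent `{0, 1}`-valued variables, the `i`-th of
which has success probability `p i`, written as a finite sum over the outcomes. -/
noncomputable def bernoulliExpect {ι : Type*} [Fintype ι] [DecidableEq ι] (p : ι → ℝ) :
    ((ι → Fin 2) → ℝ) →ₗ[ℝ] ℝ :=
  ∑ y, (∏ i, bernoulliWeight (p i) (y i)) • LinearMap.proj y

/-- The sign `2 x - 1`, which is a Rademacher variable when `x` is a fair coin. -/
def rademacherSign (x : Fin 2) : ℝ := 2 * ((x : ℕ) : ℝ) - 1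

theorem bernoulliWeight_nonneg {p : ℝ} (hp : p ∈ Set.Icc 0 1) (x : Fin 2) :
    0 ≤ bernoulliWeight p x := by
  unfold bernoulliWeight
  split_ifs
  exacts [hp.1, sub_nonneg.2 hp.2]

variable {ι : Type*} [Fintype ι] [DecidableEq ι] {p : ι → ℝ}

theorem bernoulliExpect_apply (p : ι → ℝ) (F : (ι → Fin 2) → ℝ) :
    bernoulliExpect p F = ∑ y, (∏ i, bernoulliWeight (p i) (y i)) * F y := by
  simp [bernoulliExpect]

theorem bernoulliExpect_mono (hp : ∀ i, p i ∈ Set.Icc 0 1) {F G : (ι → Fin 2) → ℝ} (h : F ≤ G) :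
    bernoulliExpect p F ≤ bernoulliExpect p G := by
  simp only [bernoulliExpect_apply]
  exact Finset.sum_le_sum fun y _ => mul_le_mul_of_nonneg_left (h y)
    (Finset.prod_nonneg fun i _ => bernoulliWeight_nonneg (hp i) _)

theorem bernoulliExpect_nonneg (hp : ∀ i, p i ∈ Set.Icc 0 1) {F : (ι → Fin 2) → ℝ} (h : 0 ≤ F) :
    0 ≤ bernoulliExpect p F :=
  (map_zero _).symm.trans_le (bernoulliExpect_mono hp h)

theorem bernoulliExpect_comp_equiv {κ : Type*} [Fintype κ] [DecidableEq κ] (e : κ ≃ ι)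
    (p : ι → ℝ) (F : (κ → Fin 2) → ℝ) :
    bernoulliExpect (p ∘ e) F = bernoulliExpect p fun y => F (y ∘ e) := by
  simp only [bernoulliExpect_apply]
  refine (Fintype.sum_equiv (e.arrowCongr (Equiv.refl _)).symm _ _ fun y => ?_).symm
  rw [← Equiv.prod_comp e]
  rfl

theorem bernoulliExpect_fin_succ {n : ℕ} (p : Fin (n + 1) → ℝ) (F : (Fin (n + 1) → Fin 2) → ℝ) :
    bernoulliExpect p F =
      (1 - p 0) * bernoulliExpect (fun i => p i.succ) (fun y => F (Fin.cons 0 y)) +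
        p 0 * bernoulliExpect (fun i => p i.succ) (fun y => F (Fin.cons 1 y)) := by
  simp only [bernoulliExpect_apply]
  rw [← (Fin.consEquiv fun _ => Fin 2).sum_comp, Fintype.sum_prod_type, Fin.sum_univ_two]
  simp [Fin.consEquiv, Fin.prod_univ_succ, bernoulliWeight, Finset.mul_sum, mul_assoc]

/-- Symmetrization and the Ledoux–Talagrand contraction principle, carried out together one
coordinate at a time: the offset `a` absorbs the coordinates that have already been replaced. -/
theorem bernoulliExpect_fin_iSup_le {α : Type*} [Finite α] [Nonempty α] {φ : ℝ → ℝ}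
    (hφ : ConvexOn ℝ Set.univ φ) (hmono : Monotone φ) {n : ℕ} {p : Fin n → ℝ}
    (hp : ∀ i, p i ∈ Set.Icc 0 1) {g b : Fin n → α → ℝ} (hgb : ∀ i t, |g i t| ≤ |b i t|)
    (hgb' : ∀ i s t, |g i s - g i t| ≤ |b i s - b i t|) (a : α → ℝ) :
    bernoulliExpect p (fun y => φ (⨆ t, a t + ∑ i, (((y i : ℕ) : ℝ) - p i) * g i t)) ≤
      bernoulliExpect (fun _ => 1 / 2)
        (fun y => φ (⨆ t, a t + ∑ i, rademacherSign (y i) * b i t)) := by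
  induction n generalizing a with
  | zero => simp [bernoulliExpect_apply]
  | succ n ih =>
    let p' (i : Fin n) := p i.succ
    let S (y : Fin n → Fin 2) (t : α) : ℝ :=
      a t + ∑ i, (((y i : ℕ) : ℝ) - p' i) * g i.succ t
    have one_coordinate :
        (1 - p 0) • (fun y => φ (⨆ t, S y t + (0 - p 0) * g 0 t)) +
            p 0 • (fun y => φ (⨆ t, S y t + (1 - p 0) * g 0 t)) ≤
          (1 / 2 : ℝ) • (fun y => φ (⨆ t, S y t - b 0 t)) +
            (1 / 2 : ℝ) • (fun y => φ (⨆ t, S y t + b 0 t)) := fun y => by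
      have h₁ := bernoulli_iSup_le_rademacher hφ hmono (S y) (g 0) (hp 0)
      have h₂ := add_iSup_le_add_iSup_of_contraction hφ hmono (S y) (hgb 0) (hgb' 0)
      simp only [Pi.add_apply, Pi.smul_apply, smul_eq_mul]
      linarith
    have h := bernoulliExpect_mono (p := p') (fun i => hp i.succ) one_coordinate
    have tail_le (c : α → ℝ) :
        bernoulliExpect p' (fun y => φ (⨆ t, S y t + c t)) ≤
          bernoulliExpect (fun _ : Fin n => 1 / 2)
            (fun y => φ (⨆ t, a t + (c t + ∑ i, rademacherSign (y i) * b i.succ t))) := by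
      simpa only [S, p', add_right_comm _ (Finset.sum _ _), add_assoc] using
        ih (fun i => hp i.succ) (fun i => hgb i.succ) (fun i => hgb' i.succ) fun t => a t + c t
    calc _ = (1 - p 0) * bernoulliExpect p'
              (fun y => φ (⨆ t, S y t + (0 - p 0) * g 0 t)) +
            p 0 * bernoulliExpect p'
              (fun y => φ (⨆ t, S y t + (1 - p 0) * g 0 t)) := by
          simp [bernoulliExpect_fin_succ, Fin.sum_univ_succ, S, p', add_assoc,
            add_comm (Finset.sum _ _)]
      _ ≤ 1 / 2 * bernoulliExpect p' (fun y => φ (⨆ t, S y t + -b 0 t)) +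
            1 / 2 * bernoulliExpect p' (fun y => φ (⨆ t, S y t + b 0 t)) := by
          simpa only [map_add, map_smul, smul_eq_mul, sub_eq_add_neg (S _ _)] using h
      _ ≤ _ := add_le_add (mul_le_mul_of_nonneg_left (tail_le _) (by norm_num))
          (mul_le_mul_of_nonneg_left (tail_le _) (by norm_num))
      _ = _ := by
          norm_num [bernoulliExpect_fin_succ, Fin.sum_univ_succ, rademacherSign]

theorem bernoulliExpect_iSup_le {α : Type*} [Finite α] [Nonempty α] {φ : ℝ → ℝ}
    (hφ : ConvexOn ℝ Set.univ φ) (hmono : Monotone φ) (hp : ∀ i, p i ∈ Set.Icc 0 1)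
    {g b : ι → α → ℝ} (hgb : ∀ i t, |g i t| ≤ |b i t|)
    (hgb' : ∀ i s t, |g i s - g i t| ≤ |b i s - b i t|) :
    bernoulliExpect p (fun y => φ (⨆ t, ∑ i, (((y i : ℕ) : ℝ) - p i) * g i t)) ≤
      bernoulliExpect (fun _ => 1 / 2)
        (fun y => φ (⨆ t, ∑ i, rademacherSign (y i) * b i t)) := by
  let e := (Fintype.equivFin ι).symm
  have h := bernoulliExpect_fin_iSup_le hφ hmono (fun k => hp (e k)) (fun k => hgb (e k))
    (fun k => hgb' (e k)) 0
  have hp' := bernoulliExpect_comp_equiv e p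
  have hhalf := bernoulliExpect_comp_equiv e fun _ : ι => 1 / 2
  simp only [Function.comp_def] at hp' hhalf
  rw [hp', hhalf] at h
  simpa only [← e.sum_comp, Pi.zero_apply, zero_add] using h

open Real in
theorem bernoulliExpect_rademacher_exp_le (c : ι → ℝ) :
    bernoulliExpect (fun _ => 1 / 2) (fun y => exp (∑ i, rademacherSign (y i) * c i)) ≤
      exp ((∑ i, c i ^ 2) / 2) := by
  have expect_eq_prod_cosh :
      bernoulliExpect (fun _ => 1 / 2) (fun y => exp (∑ i, rademacherSign (y i) * c i)) =
        ∏ i, cosh (c i) := by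
    simp only [bernoulliExpect_apply, exp_sum, ← Finset.prod_mul_distrib]
    rw [← Fintype.prod_sum fun i x => bernoulliWeight (1 / 2) x * exp (rademacherSign x * c i)]
    refine Finset.prod_congr rfl fun i _ => ?_
    norm_num [bernoulliWeight, rademacherSign, cosh_eq]
    ring
  rw [expect_eq_prod_cosh, Finset.sum_div, exp_sum]
  exact Finset.prod_le_prod (fun i _ => (cosh_pos _).le) fun i _ => cosh_le_exp_half_sq _

open Real in
theorem bernoulliExpect_indicator_exists_le {α : Type*} [Finite α] [Nonempty α]
    (hp : ∀ i, p i ∈ Set.Icc 0 1) {g b : ι → α → ℝ} (hgb : ∀ i t, |g i t| ≤ |b i t|)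
    (hgb' : ∀ i s t, |g i s - g i t| ≤ |b i s - b i t|) {W : (ι → Fin 2) → ℝ}
    (hW : ∀ y t, ∑ i, rademacherSign (y i) * b i t ≤ W y) {l : ℝ} (hl : 0 ≤ l) (τ : ℝ) :
    bernoulliExpect p
        ({y | ∃ t, τ ≤ ∑ i, (((y i : ℕ) : ℝ) - p i) * g i t}.indicator 1) ≤
      exp (-(l * τ)) * bernoulliExpect (fun _ => 1 / 2) (fun y => exp (l * W y)) := by
  let φ (x : ℝ) := exp (l * x)
  have hmono : Monotone φ := fun x y hxy => exp_le_exp.2 (mul_le_mul_of_nonneg_left hxy hl)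
  have hconv : ConvexOn ℝ Set.univ φ := convexOn_exp.comp_linearMap (LinearMap.mulLeft ℝ l)
  let G (y : ι → Fin 2) (t : α) : ℝ := ∑ i, (((y i : ℕ) : ℝ) - p i) * g i t
  have indicator_le : {y | ∃ t, τ ≤ G y t}.indicator 1 ≤
      exp (-(l * τ)) • fun y => φ (⨆ t, G y t) := by
    refine Set.indicator_le' (fun y ⟨t, ht⟩ => ?_) fun y _ =>
      mul_nonneg (exp_pos _).le (exp_pos _).le
    have hsup := ht.trans (le_ciSup (Finite.bddAbove_range (G y)) t)
    rw [Pi.one_apply, Pi.smul_apply, smul_eq_mul, ← exp_add]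
    exact one_le_exp (by linarith [mul_le_mul_of_nonneg_left hsup hl])
  calc _ ≤ exp (-(l * τ)) * bernoulliExpect p fun y => φ (⨆ t, G y t) :=
        (bernoulliExpect_mono hp indicator_le).trans_eq (map_smul _ _ _)
    _ ≤ exp (-(l * τ)) * bernoulliExpect (fun _ => 1 / 2)
          fun y => φ (⨆ t, ∑ i, rademacherSign (y i) * b i t) := by
        gcongr
        exact bernoulliExpect_iSup_le hconv hmono hp hgb hgb'
    _ ≤ _ := by
        gcongr
        exact bernoulliExpect_mono (fun _ => by norm_num) fun y => hmono (ciSup_le (hW y))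

end BernoulliExpect

section Law

open MeasureTheory ProbabilityTheory Real

variable {ι Ω : Type*} [Fintype ι] [DecidableEq ι] [MeasurableSpace Ω] {P : Measure Ω}
  [IsProbabilityMeasure P] {X : ι → Ω → Fin 2} {p : ι → ℝ}

theorem measureReal_preimage_singleton_eq_bernoulliWeight {X : Ω → Fin 2} {p : ℝ}
    (hX : Measurable X) (hp : P.real {ω | X ω = 1} = p) (x : Fin 2) :
    P.real (X ⁻¹' {x}) = bernoulliWeight p x := by
  have hp' : P.real (X ⁻¹' {1}) = p := hp
  rw [bernoulliWeight]
  split_ifs with hx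
  · rw [hx, hp']
  · have hcompl : X ⁻¹' {x} = (X ⁻¹' {1})ᶜ := by
      ext ω
      simp only [Set.mem_preimage, Set.mem_singleton_iff, Set.mem_compl_iff]
      omega
    rw [hcompl, probReal_compl_eq_one_sub (hX (measurableSet_singleton 1)), hp']

theorem measureReal_mem_eq_bernoulliExpect (hX : ∀ i, Measurable (X i)) (hindep : iIndepFun X P)
    (hp : ∀ i, P.real {ω | X i ω = 1} = p i) (B : Set (ι → Fin 2)) :
    P.real {ω | (fun i => X i ω) ∈ B} = bernoulliExpect p (B.indicator 1) := by
  classical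
  have singleton (y : ι → Fin 2) :
      P.real ((fun ω i => X i ω) ⁻¹' {y}) = ∏ i, bernoulliWeight (p i) (y i) := by
    have h := hindep.measure_inter_preimage_eq_mul Finset.univ (sets := fun i => {y i})
      fun i _ => measurableSet_singleton _
    have hinter : (fun ω i => X i ω) ⁻¹' {y} = ⋂ i ∈ Finset.univ, X i ⁻¹' {y i} := by
      ext ω
      simp [funext_iff]
    rw [measureReal_def, hinter, h, ENNReal.toReal_prod]
    exact Finset.prod_congr rfl fun i _ =>
      measureReal_preimage_singleton_eq_bernoulliWeight (hX i) (hp i) _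
  have h := sum_measureReal_preimage_singleton (μ := P) (B.toFinset) (f := fun ω i => X i ω)
    fun y _ => measurable_pi_lambda _ hX (measurableSet_singleton y)
  rw [Set.coe_toFinset] at h
  refine h.symm.trans ?_
  simp only [singleton, bernoulliExpect_apply, Set.indicator_apply, Pi.one_apply, mul_ite, mul_one,
    mul_zero, ← Finset.sum_filter]
  congr 1
  ext y
  simp

theorem measureReal_exists_le_sum_mul_le {α : Type*} (hX : ∀ i, Measurable (X i))
    (hindep : iIndepFun X P) (hp : ∀ i, P.real {ω | X i ω = 1} = p i) {g b : ι → α → ℝ}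
    (hgb : ∀ i t, |g i t| ≤ |b i t|) (hgb' : ∀ i s t, |g i s - g i t| ≤ |b i s - b i t|)
    {W : (ι → Fin 2) → ℝ} (hW : ∀ y t, ∑ i, rademacherSign (y i) * b i t ≤ W y) {l : ℝ}
    (hl : 0 ≤ l) (τ : ℝ) :
    P.real {ω | ∃ t, τ ≤ ∑ i, (((X i ω : ℕ) : ℝ) - p i) * g i t} ≤
      exp (-(l * τ)) * bernoulliExpect (fun _ => 1 / 2) (fun y => exp (l * W y)) := by
  have hp' (i : ι) : p i ∈ Set.Icc 0 1 := hp i ▸ ⟨measureReal_nonneg, measureReal_le_one⟩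
  let B : Set (ι → Fin 2) := {y | ∃ t, τ ≤ ∑ i, (((y i : ℕ) : ℝ) - p i) * g i t}
  -- There are finitely many outcomes, so one violating parameter for each bad outcome reduces
  -- the claim to a finite index type, over which the suprema are attained.
  choose t ht using fun y : B => y.2
  have hB : B = {y | ∃ z, τ ≤ ∑ i, (((y i : ℕ) : ℝ) - p i) * g i (t z)} :=
    Set.ext fun y => ⟨fun hy => ⟨⟨y, hy⟩, ht ⟨y, hy⟩⟩, fun ⟨z, hz⟩ => ⟨t z, hz⟩⟩
  refine (measureReal_mem_eq_bernoulliExpect hX hindep hp B).trans_le ?_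
  rcases isEmpty_or_nonempty B with hempty | hne
  · rw [Set.isEmpty_coe_sort.1 hempty, Set.indicator_empty]
    exact (map_zero _).trans_le (mul_nonneg (exp_pos _).le
      (bernoulliExpect_nonneg (fun _ => by norm_num) fun y => (exp_pos _).le))
  · rw [hB]
    exact bernoulliExpect_indicator_exists_le hp' (fun i z => hgb i (t z))
      (fun i z z' => hgb' i (t z) (t z')) (fun y z => hW y (t z)) hl τ

end Law

section OperatorNorm

open scoped RealInnerProductSpace

variable {E F : Type*} [NormedAddCommGroup E] [InnerProductSpace ℝ E] [CompleteSpace E]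
  [NormedAddCommGroup F] [InnerProductSpace ℝ F] [CompleteSpace F]

theorem packingNumber_one_closedBall_two_le (E : Type*) [NormedAddCommGroup E] [NormedSpace ℝ E]
    [FiniteDimensional ℝ E] :
    Metric.packingNumber 1 (Metric.closedBall (0 : E) 2) ≤ 5 ^ Module.finrank ℝ E := by
  refine iSup₂_le fun S hS => iSup_le fun hsep => ENat.forall_natCast_le_iff_le.1 fun k hk => ?_
  obtain ⟨T, hTS, hT⟩ := Set.exists_subset_encard_eq hk
  have hfin := Set.finite_of_encard_eq_coe hT
  have hcard := Besicovitch.card_le_of_separated hfin.toFinset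
    (fun c hc => by simpa using hS (hTS (hfin.mem_toFinset.1 hc)))
    fun c hc d hd hcd => by
      have h : 1 < edist c d := by
        simpa using hsep (hTS (hfin.mem_toFinset.1 hc)) (hTS (hfin.mem_toFinset.1 hd)) hcd
      rw [edist_dist, dist_eq_norm, ENNReal.one_lt_ofReal] at h
      exact h.le
  rw [← hT, hfin.encard_eq_coe_toFinset_card]
  exact_mod_cast hcard

theorem exists_norming_finset (E : Type*) [NormedAddCommGroup E] [InnerProductSpace ℝ E]
    [FiniteDimensional ℝ E] :
    ∃ S : Finset E, S.card ≤ 5 ^ Module.finrank ℝ E ∧ (∀ s ∈ S, ‖s‖ ≤ 2) ∧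
      ∀ x : E, ∃ s ∈ S, ‖x‖ ≤ ⟪s, x⟫ := by
  have hpack := packingNumber_one_closedBall_two_le E
  have hne_top : Metric.packingNumber 1 (Metric.closedBall (0 : E) 2) ≠ ⊤ :=
    ne_top_of_le_ne_top (by simp) hpack
  rw [← Metric.encard_maximalSeparatedSet hne_top] at hpack
  have hfin : (Metric.maximalSeparatedSet 1 (Metric.closedBall (0 : E) 2)).Finite :=
    Set.finite_of_encard_le_coe (k := 5 ^ Module.finrank ℝ E) (by exact_mod_cast hpack)
  refine ⟨hfin.toFinset, ?_, fun s hs => ?_, fun x => ?_⟩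
  · rw [hfin.encard_eq_coe_toFinset_card] at hpack
    exact_mod_cast hpack
  · simpa using Metric.maximalSeparatedSet_subset (hfin.mem_toFinset.1 hs)
  · have hu : (2 / ‖x‖) • x ∈ Metric.closedBall (0 : E) 2 := by
      rcases eq_or_ne x 0 with rfl | hx
      · simp
      · simp [norm_smul, hx]
    obtain ⟨s, hs, hdist⟩ := Metric.isCover_maximalSeparatedSet hne_top hu
    refine ⟨s, hfin.mem_toFinset.2 hs, ?_⟩
    have hus : ‖(2 / ‖x‖) • x - s‖ ≤ 1 := by
      have h : edist ((2 / ‖x‖) • x) s ≤ 1 := by simpa using hdist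
      rwa [edist_dist, dist_eq_norm, ENNReal.ofReal_le_one] at h
    have hux : ⟪(2 / ‖x‖) • x, x⟫ = 2 * ‖x‖ := by
      rcases eq_or_ne x 0 with rfl | hx
      · simp
      · rw [real_inner_smul_left, real_inner_self_eq_norm_sq]
        field_simp
    have h := (real_inner_le_norm _ x).trans (mul_le_of_le_one_left (norm_nonneg x) hus)
    rw [inner_sub_left, hux] at h
    linarith

theorem exists_opNorm_le_inner {S : Finset F} {T : Finset E} (hS : ∀ x : F, ∃ s ∈ S, ‖x‖ ≤ ⟪s, x⟫)
    (hT : ∀ x : E, ∃ t ∈ T, ‖x‖ ≤ ⟪t, x⟫) (A : E →L[ℝ] F) :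
    ∃ s ∈ S, ∃ t ∈ T, ‖A‖ ≤ ⟪s, A t⟫ := by
  obtain ⟨t₀, ht₀, -⟩ := hT 0
  obtain ⟨t, ht, hmax⟩ := T.exists_max_image (fun t => ‖A t‖) ⟨t₀, ht₀⟩
  obtain ⟨s, hs, hst⟩ := hS (A t)
  refine ⟨s, hs, t, ht, le_trans ?_ hst⟩
  rw [← ContinuousLinearMap.adjoint.norm_map A]
  refine ContinuousLinearMap.opNorm_le_bound _ (norm_nonneg _) fun u => ?_
  obtain ⟨t', ht', hu⟩ := hT (ContinuousLinearMap.adjoint A u)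
  rw [ContinuousLinearMap.adjoint_inner_right] at hu
  exact hu.trans ((real_inner_le_norm _ _).trans
    (mul_le_mul_of_nonneg_right (hmax t' ht') (norm_nonneg _)))

end OperatorNorm

section SignMatrix

open scoped RealInnerProductSpace Matrix.Norms.L2Operator
open Real

variable {m n κ : Type*} [Fintype m] [Fintype n] [Fintype κ] [DecidableEq n]

/-- The random sign matrix attached to an array of coin tosses. -/
def signMatrix (y : m × n → Fin 2) : Matrix m n ℝ := Matrix.of fun i j => rademacherSign (y (i, j))

theorem exists_l2_opNorm_le_sum {S : Finset (EuclideanSpace ℝ m)}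
    {T : Finset (EuclideanSpace ℝ n)} (hS : ∀ x, ∃ s ∈ S, ‖x‖ ≤ ⟪s, x⟫)
    (hT : ∀ x, ∃ t ∈ T, ‖x‖ ≤ ⟪t, x⟫) (Z : Matrix m n ℝ) :
    ∃ s ∈ S, ∃ t ∈ T, ‖Z‖ ≤ ∑ q : m × n, Z q.1 q.2 * (s q.1 * t q.2) := by
  obtain ⟨s, hs, t, ht, h⟩ := exists_opNorm_le_inner hS hT
    ((Matrix.toEuclideanLin (𝕜 := ℝ) ≪≫ₗ LinearMap.toContinuousLinearMap) Z)
  refine ⟨s, hs, t, ht, (Matrix.l2_opNorm_def Z).trans_le (h.trans_eq ?_)⟩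
  simp [PiLp.inner_apply, Matrix.toLpLin_apply, Matrix.mulVec, dotProduct, Fintype.sum_prod_type,
    Finset.sum_mul, mul_assoc, mul_comm (s _)]

theorem bernoulliExpect_exp_mul_norm_signMatrix_le [DecidableEq m] {l : ℝ} (hl : 0 ≤ l) :
    bernoulliExpect (fun _ => 1 / 2) (fun y : m × n → Fin 2 => exp (l * ‖signMatrix y‖)) ≤
      5 ^ (Fintype.card m + Fintype.card n) * exp (8 * l ^ 2) := by
  obtain ⟨S, hS_card, hS_norm, hS⟩ := exists_norming_finset (EuclideanSpace ℝ m)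
  obtain ⟨T, hT_card, hT_norm, hT⟩ := exists_norming_finset (EuclideanSpace ℝ n)
  rw [finrank_euclideanSpace] at hS_card hT_card
  let B (y : m × n → Fin 2) (r : EuclideanSpace ℝ m × EuclideanSpace ℝ n) : ℝ :=
    ∑ q : m × n, rademacherSign (y q) * (l * (r.1 q.1 * r.2 q.2))
  have exp_norm_le : (fun y : m × n → Fin 2 => exp (l * ‖signMatrix y‖)) ≤
      ∑ r ∈ S ×ˢ T, fun y => exp (B y r) := fun y => by
    obtain ⟨s, hs, t, ht, h⟩ := exists_l2_opNorm_le_sum hS hT (signMatrix y)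
    rw [Finset.sum_apply]
    refine le_trans (exp_le_exp.2 ?_) (Finset.single_le_sum (f := fun r => exp (B y r))
      (fun _ _ => (exp_pos _).le) (Finset.mk_mem_product hs ht))
    refine (mul_le_mul_of_nonneg_left h hl).trans_eq ?_
    simp only [B, Finset.mul_sum, signMatrix, Matrix.of_apply, mul_left_comm l]
  have expect_exp_le : ∀ r ∈ S ×ˢ T,
      bernoulliExpect (fun _ => 1 / 2) (fun y => exp (B y r)) ≤ exp (8 * l ^ 2) := by
    rintro ⟨s, t⟩ hr
    obtain ⟨hs, ht⟩ := Finset.mem_product.1 hr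
    refine (bernoulliExpect_rademacher_exp_le _).trans (exp_le_exp.2 ?_)
    have sum_sq : ∑ q : m × n, (l * (s q.1 * t q.2)) ^ 2 = l ^ 2 * (‖s‖ ^ 2 * ‖t‖ ^ 2) := by
      rw [EuclideanSpace.real_norm_sq_eq, EuclideanSpace.real_norm_sq_eq, Fintype.sum_mul_sum,
        Fintype.sum_prod_type, Finset.mul_sum]
      simp only [Finset.mul_sum, mul_pow]
    have norm_le : ‖s‖ ^ 2 * ‖t‖ ^ 2 ≤ 2 ^ 2 * 2 ^ 2 := by
      gcongr
      exacts [hS_norm s hs, hT_norm t ht]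
    rw [sum_sq]
    linarith [mul_le_mul_of_nonneg_left norm_le (sq_nonneg l)]
  calc _ ≤ ∑ r ∈ S ×ˢ T, bernoulliExpect (fun _ => 1 / 2) fun y => exp (B y r) :=
        (bernoulliExpect_mono (fun _ => by norm_num) exp_norm_le).trans_eq (map_sum _ _ _)
    _ ≤ (S ×ˢ T).card • exp (8 * l ^ 2) := Finset.sum_le_card_nsmul _ _ _ expect_exp_le
    _ ≤ _ := by
      rw [nsmul_eq_mul, Finset.card_product, pow_add]
      push_cast
      gcongr
      exacts [mod_cast hS_card, mod_cast hT_card]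

theorem abs_sum_mul_le_norm_mul (Z : Matrix m n ℝ) (U : Matrix m κ ℝ) (V : Matrix n κ ℝ) :
    |∑ i, ∑ j, Z i j * (U * V.transpose) i j| ≤
      ‖Z‖ * (√(∑ i, ∑ k, U i k ^ 2) * √(∑ j, ∑ k, V j k ^ 2)) := by
  let u (k : κ) : EuclideanSpace ℝ m := WithLp.toLp 2 (U.col k)
  let v (k : κ) : EuclideanSpace ℝ n := WithLp.toLp 2 (V.col k)
  let Zv (k : κ) : EuclideanSpace ℝ m := WithLp.toLp 2 (Z.mulVec (v k))
  have columns : ∑ i, ∑ j, Z i j * (U * V.transpose) i j = ∑ k, ⟪u k, Zv k⟫ := by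
    simp only [PiLp.inner_apply, u, v, Zv, Matrix.mul_apply, Matrix.transpose_apply, Matrix.mulVec,
      dotProduct, Finset.mul_sum, RCLike.inner_apply, conj_trivial, Finset.sum_mul,
      Matrix.col_apply]
    rw [Finset.sum_comm (s := Finset.univ (α := κ))]
    refine Finset.sum_congr rfl fun i _ => Finset.sum_comm.trans ?_
    exact Finset.sum_congr rfl fun k _ => Finset.sum_congr rfl fun j _ => by ring
  calc |∑ i, ∑ j, Z i j * (U * V.transpose) i j|
      ≤ ∑ k, ‖u k‖ * (‖Z‖ * ‖v k‖) := by
        rw [columns]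
        refine (Finset.abs_sum_le_sum_abs _ _).trans (Finset.sum_le_sum fun k _ => ?_)
        exact (abs_real_inner_le_norm _ _).trans
          (mul_le_mul_of_nonneg_left (Z.l2_opNorm_mulVec (v k)) (norm_nonneg _))
    _ = ‖Z‖ * ∑ k, √(∑ i, U i k ^ 2) * √(∑ j, V j k ^ 2) := by
        simp only [EuclideanSpace.norm_eq, u, v, Finset.mul_sum, Matrix.col_apply, norm_eq_abs,
          sq_abs, mul_left_comm ‖Z‖]
    _ ≤ _ := by
        rw [Finset.sum_comm, Finset.sum_comm (s := Finset.univ (α := n))]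
        gcongr
        exact sum_sqrt_mul_sqrt_le _ (fun _ => by positivity) (fun _ => by positivity)

end SignMatrix

section Params

variable {N J K : ℕ} {C : ℝ} {ψ : IFAParams N J K}

/-- The person parameters extended by a constant column: row `i` is `(1, θ_i)`. -/
def IFAParams.personFactor (ψ : IFAParams N J K) : Matrix (Fin N) (Unit ⊕ Fin K) ℝ :=
  Matrix.fromCols (Matrix.replicateCol Unit 1) ψ.Θ

/-- The loadings extended by the intercepts: row `j` is `(d_j, a_j)`. -/
def IFAParams.itemFactor (ψ : IFAParams N J K) : Matrix (Fin J) (Unit ⊕ Fin K) ℝ :=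
  Matrix.fromCols (Matrix.replicateCol Unit ψ.d) ψ.A

theorem IFAParams.predictor_eq_personFactor_mul (ψ : IFAParams N J K) :
    ψ.predictor = ψ.personFactor * ψ.itemFactor.transpose := by
  ext i j
  simp [predictor, personFactor, itemFactor, Matrix.mul_apply, Matrix.vecMulVec_apply, add_comm]

theorem mem_feasibleSet_iff :
    ψ ∈ feasibleSet N J K C ↔
      (∀ i, √(∑ k, ψ.personFactor i k ^ 2) ≤ C) ∧ ∀ j, √(∑ k, ψ.itemFactor j k ^ 2) ≤ C := by
  simp [feasibleSet, EuclideanSpace.real_norm_sq_eq, IFAParams.personFactor, IFAParams.itemFactor]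

theorem sum_personFactor_sq_le (hψ : ψ ∈ feasibleSet N J K C) (i : Fin N) :
    ∑ k, ψ.personFactor i k ^ 2 ≤ C ^ 2 :=
  (Real.sqrt_le_iff.1 ((mem_feasibleSet_iff.1 hψ).1 i)).2

theorem sum_itemFactor_sq_le (hψ : ψ ∈ feasibleSet N J K C) (j : Fin J) :
    ∑ k, ψ.itemFactor j k ^ 2 ≤ C ^ 2 :=
  (Real.sqrt_le_iff.1 ((mem_feasibleSet_iff.1 hψ).2 j)).2

theorem abs_predictor_le (hψ : ψ ∈ feasibleSet N J K C) (i : Fin N) (j : Fin J) :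
    |ψ.predictor i j| ≤ C ^ 2 := by
  rw [ψ.predictor_eq_personFactor_mul, Matrix.mul_apply]
  refine abs_le_of_sq_le_sq ?_ (sq_nonneg C)
  calc _ ≤ (∑ k, ψ.personFactor i k ^ 2) * ∑ k, ψ.itemFactor j k ^ 2 :=
        Finset.sum_mul_sq_le_sq_mul_sq _ _ _
    _ ≤ C ^ 2 * C ^ 2 := by
        gcongr
        exacts [sum_personFactor_sq_le hψ i, sum_itemFactor_sq_le hψ j]
    _ = (C ^ 2) ^ 2 := (sq _).symm

open scoped Matrix.Norms.L2Operator in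
theorem abs_sum_mul_predictor_le (hψ : ψ ∈ feasibleSet N J K C) (Z : Matrix (Fin N) (Fin J) ℝ) :
    |∑ i, ∑ j, Z i j * ψ.predictor i j| ≤ ‖Z‖ * (C ^ 2 * √((N : ℝ) * J)) := by
  have person_le : ∑ i, ∑ k, ψ.personFactor i k ^ 2 ≤ N * C ^ 2 := by
    simpa using Finset.sum_le_card_nsmul Finset.univ _ _ fun i _ => sum_personFactor_sq_le hψ i
  have item_le : ∑ j, ∑ k, ψ.itemFactor j k ^ 2 ≤ J * C ^ 2 := by
    simpa using Finset.sum_le_card_nsmul Finset.univ _ _ fun j _ => sum_itemFactor_sq_le hψ j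
  rw [ψ.predictor_eq_personFactor_mul]
  refine (abs_sum_mul_le_norm_mul Z _ _).trans
    (mul_le_mul_of_nonneg_left ?_ (norm_nonneg _))
  calc _ ≤ √(N * C ^ 2) * √(J * C ^ 2) := by gcongr
    _ = √((C ^ 2) ^ 2 * (N * J)) := by
        rw [← Real.sqrt_mul (by positivity)]
        ring_nf
    _ = C ^ 2 * √((N : ℝ) * J) := by
        rw [Real.sqrt_mul (by positivity), Real.sqrt_sq (sq_nonneg C)]

end Params

section Link

open Real

variable {f : ℝ → ℝ} {C : ℝ}

/-- The log-odds `log (f x / (1 - f x))` of a success probability `f x`, as a function of the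
linear predictor `x`. The statistical fluctuation of the log-likelihood is linear in it. -/
noncomputable def logOdds (f : ℝ → ℝ) (x : ℝ) : ℝ := log (f x) - log (1 - f x)

/-- The Kullback–Leibler divergence from the Bernoulli distribution with success probability `q`
to the one with success probability `p`, for `p` and `q` in the open unit interval. -/
noncomputable def bernoulliKL (p q : ℝ) : ℝ :=
  p * (log p - log q) + (1 - p) * (log (1 - p) - log (1 - q))

theorem sq_sqrt_sub_sqrt_le {p q : ℝ} (hp : 0 < p) (hq : 0 < q) :
    (√p - √q) ^ 2 ≤ p * (log p - log q) - p + q := by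
  have hp' := sqrt_pos.2 hp
  have hq' := sqrt_pos.2 hq
  have h := log_le_sub_one_of_pos (div_pos hq' hp')
  rw [log_div hq'.ne' hp'.ne', log_sqrt hq.le, log_sqrt hp.le] at h
  have hsqrt : p * (√q / √p) = √p * √q := by
    nth_rewrite 1 [← mul_self_sqrt hp.le]
    field_simp
  rw [sub_sq, sq_sqrt hp.le, sq_sqrt hq.le]
  linear_combination (2 * p) * h + 2 * hsqrt

theorem sq_sub_le_four_mul_bernoulliKL {p q : ℝ} (hp : p ∈ Set.Ioo 0 1) (hq : q ∈ Set.Ioo 0 1) :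
    (p - q) ^ 2 ≤ 4 * bernoulliKL p q := by
  have hellinger_le : (√p - √q) ^ 2 ≤ bernoulliKL p q := by
    have h₀ := sq_sqrt_sub_sqrt_le (sub_pos.2 hp.2) (sub_pos.2 hq.2)
    rw [bernoulliKL]
    linarith [sq_sqrt_sub_sqrt_le hp.1 hq.1, sq_nonneg (√(1 - p) - √(1 - q))]
  have hadd : (√p + √q) ^ 2 ≤ (1 + 1) ^ 2 := by
    gcongr
    exacts [sqrt_le_one.2 hp.2.le, sqrt_le_one.2 hq.2.le]
  calc (p - q) ^ 2 = (√p + √q) ^ 2 * (√p - √q) ^ 2 := by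
        rw [← mul_pow, ← sq_sub_sq, sq_sqrt hp.1.le, sq_sqrt hq.1.le]
    _ ≤ (1 + 1) ^ 2 * bernoulliKL p q := by gcongr
    _ = 4 * bernoulliKL p q := by norm_num

theorem hasDerivAt_logOdds {x : ℝ} (hf : DifferentiableAt ℝ f x) (h₀ : f x ≠ 0)
    (h₁ : 1 - f x ≠ 0) :
    HasDerivAt (logOdds f) (deriv f x / (f x * (1 - f x))) x := by
  refine ((hf.hasDerivAt.log h₀).sub ((hf.hasDerivAt.const_sub 1).log h₁)).congr_deriv ?_
  field_simp
  ring

theorem mul_sq_sub_le_of_le_sq_deriv {s : Set ℝ} (hs : s.OrdConnected) {c : ℝ}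
    (hf : ∀ z ∈ s, DifferentiableAt ℝ f z) (hc : ∀ z ∈ s, c ≤ deriv f z ^ 2) {x y : ℝ}
    (hx : x ∈ s) (hy : y ∈ s) :
    c * (x - y) ^ 2 ≤ (f x - f y) ^ 2 := by
  wlog hxy : x ≤ y generalizing x y
  · rw [sub_sq_comm x, sub_sq_comm (f x)]
    exact this hy hx (le_of_not_ge hxy)
  rcases hxy.eq_or_lt with rfl | hlt
  · simp
  have hsub : Set.Icc x y ⊆ s := hs.out hx hy
  obtain ⟨z, hz, hslope⟩ := exists_deriv_eq_slope f hlt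
    (fun w hw => (hf w (hsub hw)).continuousAt.continuousWithinAt)
    (fun w hw => (hf w (hsub (Set.Ioo_subset_Icc_self hw))).differentiableWithinAt)
  rw [eq_div_iff (sub_pos.2 hlt).ne'] at hslope
  calc c * (x - y) ^ 2 ≤ deriv f z ^ 2 * (x - y) ^ 2 := by
        gcongr
        exact hc z (hsub (Set.Ioo_subset_Icc_self hz))
    _ = (deriv f z * (y - x)) ^ 2 := by ring
    _ = (f x - f y) ^ 2 := by rw [hslope, sub_sq_comm]

theorem LinkRegular.mem_Ioo (hf : LinkRegular f C) {x : ℝ} (hx : |x| ≤ C ^ 2) :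
    f x ∈ Set.Ioo 0 1 :=
  ⟨hf.pos x hx, hf.lt_one x hx⟩

theorem LinkRegular.exists_logOdds_lipschitz (hf : LinkRegular f C) :
    ∃ L : ℝ, 0 < L ∧ ∀ x y, |x| ≤ C ^ 2 → |y| ≤ C ^ 2 →
      |logOdds f x - logOdds f y| ≤ L * |x - y| := by
  obtain ⟨B, hB⟩ := hf.bdd_score
  refine ⟨max B 1, by positivity, fun x y hx hy => ?_⟩
  have hderiv : ∀ z ∈ Set.Icc (-C ^ 2) (C ^ 2), HasDerivWithinAt (logOdds f)
      (deriv f z / (f z * (1 - f z))) (Set.Icc (-C ^ 2) (C ^ 2)) z := fun z hz => by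
    obtain ⟨h₀, h₁⟩ := hf.mem_Ioo (abs_le.2 hz)
    exact (hasDerivAt_logOdds (hf.differentiable z) h₀.ne' (sub_pos.2 h₁).ne').hasDerivWithinAt
  have hbound : ∀ z ∈ Set.Icc (-C ^ 2) (C ^ 2), ‖deriv f z / (f z * (1 - f z))‖ ≤ max B 1 :=
    fun z hz => by
      obtain ⟨h₀, h₁⟩ := hf.mem_Ioo (abs_le.2 hz)
      rw [norm_eq_abs, abs_div, abs_of_pos (mul_pos h₀ (sub_pos.2 h₁))]
      exact (hB ⟨z, abs_le.2 hz, rfl⟩).trans (le_max_left _ _)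
  exact (convex_Icc _ _).norm_image_sub_le_of_norm_hasDerivWithin_le hderiv hbound
    (abs_le.1 hy) (abs_le.1 hx)

theorem LinkRegular.exists_le_sq_deriv (hf : LinkRegular f C) :
    ∃ c : ℝ, 0 < c ∧ ∀ x, |x| ≤ C ^ 2 → c ≤ deriv f x ^ 2 := by
  obtain ⟨B, hB⟩ := hf.bdd_inv_info
  have hcont : Continuous f := hf.differentiable.continuous
  obtain ⟨z, hz, hmin⟩ := (isCompact_Icc (a := -C ^ 2) (b := C ^ 2)).exists_isMinOn
    ⟨0, by simp [sq_nonneg]⟩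
    (show ContinuousOn (fun x => f x * (1 - f x)) _ by fun_prop)
  obtain ⟨h₀, h₁⟩ := hf.mem_Ioo (abs_le.2 hz)
  refine ⟨f z * (1 - f z) / max B 1, div_pos (mul_pos h₀ (sub_pos.2 h₁)) (by positivity),
    fun x hx => ?_⟩
  have hle : f x * (1 - f x) / deriv f x ^ 2 ≤ max B 1 :=
    (hB ⟨x, hx, rfl⟩).trans (le_max_left _ _)
  rw [div_le_iff₀ (sq_pos_of_ne_zero (hf.deriv_ne_zero x hx))] at hle
  exact (div_le_iff₀' (by positivity)).2 ((hmin (abs_le.1 hx)).trans hle)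

theorem LinkRegular.exists_sq_sub_le_bernoulliKL (hf : LinkRegular f C) :
    ∃ c : ℝ, 0 < c ∧ ∀ x y, |x| ≤ C ^ 2 → |y| ≤ C ^ 2 →
      c * (x - y) ^ 2 ≤ bernoulliKL (f y) (f x) := by
  obtain ⟨c, hc, hderiv⟩ := hf.exists_le_sq_deriv
  refine ⟨c / 4, by positivity, fun x y hx hy => ?_⟩
  have h := mul_sq_sub_le_of_le_sq_deriv (Set.ordConnected_Icc (a := -C ^ 2) (b := C ^ 2))
    (fun z _ => hf.differentiable z) (fun z hz => hderiv z (abs_le.2 hz)) (abs_le.1 hy)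
    (abs_le.1 hx)
  rw [sub_sq_comm]
  linarith [sq_sub_le_four_mul_bernoulliKL (hf.mem_Ioo hy) (hf.mem_Ioo hx)]

end Link

section Likelihood

variable {N J K : ℕ} {f : ℝ → ℝ} {C c : ℝ} {ψ ψ₀ : IFAParams N J K} {y : Fin N → Fin J → Fin 2}

theorem LinkRegular.predictor_mem_Ioo (hf : LinkRegular f C) (hψ : ψ ∈ feasibleSet N J K C)
    (i : Fin N) (j : Fin J) : f (ψ.predictor i j) ∈ Set.Ioo 0 1 :=
  hf.mem_Ioo (abs_predictor_le hψ i j)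

theorem jointLik_factor_pos (hψ : ∀ i j, f (ψ.predictor i j) ∈ Set.Ioo 0 1) (i : Fin N)
    (j : Fin J) :
    0 < f (ψ.predictor i j) ^ (y i j : ℕ) * (1 - f (ψ.predictor i j)) ^ (1 - (y i j : ℕ)) :=
  mul_pos (pow_pos (hψ i j).1 _) (pow_pos (sub_pos.2 (hψ i j).2) _)

theorem log_jointLik (hψ : ∀ i j, f (ψ.predictor i j) ∈ Set.Ioo 0 1) :
    Real.log (jointLik f y ψ) = ∑ i, ∑ j, (((y i j : ℕ) : ℝ) * logOdds f (ψ.predictor i j) +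
      Real.log (1 - f (ψ.predictor i j))) := by
  have factor_pos := jointLik_factor_pos (y := y) hψ
  rw [jointLik, Real.log_prod fun i _ => (Finset.prod_pos fun j _ => factor_pos i j).ne']
  refine Finset.sum_congr rfl fun i _ => ?_
  rw [Real.log_prod fun j _ => (factor_pos i j).ne']
  refine Finset.sum_congr rfl fun j _ => ?_
  generalize y i j = x
  fin_cases x <;> simp [logOdds]

/-- The parameters with the given coordinates, through which the constraint set is viewed as a
subset of a finite-dimensional space. -/
def IFAParams.ofCoords (q : (Fin N → Fin K → ℝ) × (Fin J → Fin K → ℝ) × (Fin J → ℝ)) :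
    IFAParams N J K :=
  ⟨q.1, q.2.1, q.2.2⟩

theorem IFAParams.continuous_predictor_ofCoords :
    Continuous fun q => (ofCoords (N := N) (J := J) (K := K) q).predictor := by
  unfold predictor ofCoords
  fun_prop

theorem isClosed_preimage_feasibleSet :
    IsClosed (IFAParams.ofCoords ⁻¹' feasibleSet N J K C) := by
  have hset : IFAParams.ofCoords ⁻¹' feasibleSet N J K C =
      (⋂ i, {q | √(1 + ∑ k, q.1 i k ^ 2) ≤ C}) ∩
        ⋂ j, {q | √(q.2.2 j ^ 2 + ∑ k, q.2.1 j k ^ 2) ≤ C} := by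
    ext q
    simp [feasibleSet, EuclideanSpace.real_norm_sq_eq, IFAParams.ofCoords]
  rw [hset]
  exact (isClosed_iInter fun i => isClosed_le (by fun_prop) continuous_const).inter
    (isClosed_iInter fun j => isClosed_le (by fun_prop) continuous_const)

theorem preimage_feasibleSet_subset_Icc :
    IFAParams.ofCoords ⁻¹' feasibleSet N J K C ⊆
      Set.Icc (fun _ _ => -|C|, fun _ _ => -|C|, fun _ => -|C|)
        (fun _ _ => |C|, fun _ _ => |C|, fun _ => |C|) := by
  intro q hq
  have entry_mem {ι : Type} [Fintype ι] {x : ι → ℝ} (hx : ∑ k, x k ^ 2 ≤ C ^ 2) (k : ι) :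
      x k ∈ Set.Icc (-|C|) |C| :=
    abs_le.1 (sq_le_sq.1 ((Finset.single_le_sum (f := fun k => x k ^ 2)
      (fun _ _ => sq_nonneg _) (Finset.mem_univ k)).trans hx))
  have hΘ (i k) := entry_mem (sum_personFactor_sq_le hq i) (Sum.inr k)
  have hA (j k) := entry_mem (sum_itemFactor_sq_le hq j) (Sum.inr k)
  have hd (j) := entry_mem (sum_itemFactor_sq_le hq j) (Sum.inl ())
  exact ⟨⟨fun i k => (hΘ i k).1, fun j k => (hA j k).1, fun j => (hd j).1⟩,
    fun i k => (hΘ i k).2, fun j k => (hA j k).2, fun j => (hd j).2⟩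

theorem LinkRegular.exists_isCJMLE (hf : LinkRegular f C) (hne : (feasibleSet N J K C).Nonempty)
    (y : Fin N → Fin J → Fin 2) : ∃ ψ : IFAParams N J K, IsCJMLE f C y ψ := by
  have hcompact : IsCompact (IFAParams.ofCoords ⁻¹' feasibleSet N J K C) :=
    isCompact_Icc.of_isClosed_subset isClosed_preimage_feasibleSet preimage_feasibleSet_subset_Icc
  have hcont : ContinuousOn (fun q => Real.log (jointLik f y (IFAParams.ofCoords q)))
      (IFAParams.ofCoords ⁻¹' feasibleSet N J K C) := by
    have hf_cont : Continuous f := hf.differentiable.continuous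
    have hpred (i : Fin N) (j : Fin J) :
        Continuous fun q => (IFAParams.ofCoords (K := K) q).predictor i j :=
      IFAParams.continuous_predictor_ofCoords.matrix_elem i j
    refine ContinuousOn.log (Continuous.continuousOn ?_) fun q hq => ?_
    · unfold jointLik
      fun_prop
    · exact (Finset.prod_pos fun i _ => Finset.prod_pos fun j _ =>
        jointLik_factor_pos (hf.predictor_mem_Ioo hq) i j).ne'
  obtain ⟨ψ₁, hψ₁⟩ := hne
  obtain ⟨q, hq, hmax⟩ := hcompact.exists_isMaxOn ⟨(ψ₁.Θ, ψ₁.A, ψ₁.d), hψ₁⟩ hcont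
  exact ⟨_, hq, isMaxOn_iff.2 fun ψ hψ => isMaxOn_iff.1 hmax (ψ.Θ, ψ.A, ψ.d) hψ⟩

/-- The log-likelihood ratio of `ψ` against `ψ₀`, centred at its expectation under `ψ₀`: the
stochastic term that controls the estimation error of a maximum likelihood estimate. -/
noncomputable def centeredLogLikRatio (f : ℝ → ℝ) (ψ₀ : IFAParams N J K)
    (y : Fin N → Fin J → Fin 2) (ψ : IFAParams N J K) : ℝ :=
  ∑ i, ∑ j, (((y i j : ℕ) : ℝ) - f (ψ₀.predictor i j)) *
    (logOdds f (ψ.predictor i j) - logOdds f (ψ₀.predictor i j))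

theorem log_jointLik_sub_log_jointLik (hψ : ∀ i j, f (ψ.predictor i j) ∈ Set.Ioo 0 1)
    (hψ₀ : ∀ i j, f (ψ₀.predictor i j) ∈ Set.Ioo 0 1) :
    Real.log (jointLik f y ψ) - Real.log (jointLik f y ψ₀) =
      centeredLogLikRatio f ψ₀ y ψ -
        ∑ i, ∑ j, bernoulliKL (f (ψ₀.predictor i j)) (f (ψ.predictor i j)) := by
  rw [log_jointLik hψ, log_jointLik hψ₀, centeredLogLikRatio]
  simp only [← Finset.sum_sub_distrib]
  refine Finset.sum_congr rfl fun i _ => Finset.sum_congr rfl fun j _ => ?_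
  rw [logOdds, logOdds, bernoulliKL]
  ring

theorem IsCJMLE.mul_frobNorm_sq_le (hψ : IsCJMLE f C y ψ) (hf : LinkRegular f C)
    (hkl : ∀ x x', |x| ≤ C ^ 2 → |x'| ≤ C ^ 2 → c * (x - x') ^ 2 ≤ bernoulliKL (f x') (f x))
    (hψ₀ : ψ₀ ∈ feasibleSet N J K C) :
    c * frobNorm (ψ.predictor - ψ₀.predictor) ^ 2 ≤ centeredLogLikRatio f ψ₀ y ψ := by
  have sum_kl_le : ∑ i, ∑ j, bernoulliKL (f (ψ₀.predictor i j)) (f (ψ.predictor i j)) ≤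
      centeredLogLikRatio f ψ₀ y ψ := by
    rw [← sub_nonneg, ← log_jointLik_sub_log_jointLik (hf.predictor_mem_Ioo hψ.1)
      (hf.predictor_mem_Ioo hψ₀), sub_nonneg]
    exact isMaxOn_iff.1 hψ.2 ψ₀ hψ₀
  refine le_trans ?_ sum_kl_le
  rw [frobNorm, Real.sq_sqrt (by positivity)]
  simp only [Finset.mul_sum]
  exact Finset.sum_le_sum fun i _ => Finset.sum_le_sum fun j _ =>
    hkl _ _ (abs_predictor_le hψ.1 i j) (abs_predictor_le hψ₀ i j)

end Likelihood

section Deviation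

open MeasureTheory Real
open scoped Matrix.Norms.L2Operator

variable {N J K : ℕ} {f : ℝ → ℝ} {C L : ℝ} {ψ ψ₀ : IFAParams N J K}

theorem sum_rademacherSign_mul_predictor_sub_le (hψ : ψ ∈ feasibleSet N J K C)
    (hψ₀ : ψ₀ ∈ feasibleSet N J K C) (hL : 0 ≤ L) (y : Fin N × Fin J → Fin 2) :
    ∑ q : Fin N × Fin J, rademacherSign (y q) *
        (L * (ψ.predictor q.1 q.2 - ψ₀.predictor q.1 q.2)) ≤
      2 * (L * C ^ 2) * √((N : ℝ) * J) * ‖signMatrix y‖ := by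
  have h := le_of_abs_le (abs_sum_mul_predictor_le hψ (signMatrix y))
  have h₀ := neg_le_of_abs_le (abs_sum_mul_predictor_le hψ₀ (signMatrix y))
  calc _ = L * (∑ i, ∑ j, signMatrix y i j * ψ.predictor i j -
          ∑ i, ∑ j, signMatrix y i j * ψ₀.predictor i j) := by
        simp only [signMatrix, Matrix.of_apply, Fintype.sum_prod_type, Finset.mul_sum, mul_sub,
          ← Finset.sum_sub_distrib, mul_left_comm L]
    _ ≤ L * (‖signMatrix y‖ * (C ^ 2 * √((N : ℝ) * J)) +
          ‖signMatrix y‖ * (C ^ 2 * √((N : ℝ) * J))) := by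
        gcongr
        linarith
    _ = _ := by ring

theorem exp_neg_mul_five_pow_mul_exp_le_one_div {n : ℕ} (hn : 0 < n) :
    exp (-(11 * n)) * (5 ^ n * exp (8 * n)) ≤ 1 / n := by
  have five_le : (5 : ℝ) ≤ exp 2 := by
    have h := exp_one_gt_d9
    rw [show (2 : ℝ) = 1 + 1 by norm_num, exp_add]
    nlinarith
  have five_pow_le : (5 : ℝ) ^ n ≤ exp (2 * n) := by
    rw [mul_comm, exp_nat_mul]
    gcongr
  calc _ ≤ exp (-(11 * n)) * (exp (2 * n) * exp (8 * n)) := by gcongr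
    _ = 1 / exp n := by
        rw [one_div, ← exp_neg, ← exp_add, ← exp_add]
        ring_nf
    _ ≤ 1 / n := by
        gcongr
        linarith [add_one_le_exp (n : ℝ)]

variable {Ω : Type*} [MeasurableSpace Ω] {P : Measure Ω} [IsProbabilityMeasure P]

theorem IsIFAModel.measureReal_exists_le_centeredLogLikRatio_le_exp
    {Y : Fin N → Fin J → Ω → Fin 2} (hY : IsIFAModel P f ψ₀ Y) (hψ₀ : ψ₀ ∈ feasibleSet N J K C)
    (hL : 0 ≤ L)
    (hlip : ∀ x x', |x| ≤ C ^ 2 → |x'| ≤ C ^ 2 → |logOdds f x - logOdds f x'| ≤ L * |x - x'|)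
    {l : ℝ} (hl : 0 ≤ l) (τ : ℝ) :
    P.real {ω | ∃ ψ : feasibleSet N J K C,
        τ ≤ centeredLogLikRatio f ψ₀ (fun i j => Y i j ω) ψ} ≤
      exp (-(l * τ)) *
        (5 ^ (N + J) * exp (8 * (l * (2 * (L * C ^ 2) * √((N : ℝ) * J))) ^ 2)) := by
  let s : ℝ := 2 * (L * C ^ 2) * √((N : ℝ) * J)
  have deviation := measureReal_exists_le_sum_mul_le
    (fun q : Fin N × Fin J => hY.measurable q.1 q.2) hY.indep (fun q => hY.prob_one q.1 q.2)
    (g := fun q (ψ : feasibleSet N J K C) =>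
      logOdds f (ψ.1.predictor q.1 q.2) - logOdds f (ψ₀.predictor q.1 q.2))
    (b := fun q ψ => L * (ψ.1.predictor q.1 q.2 - ψ₀.predictor q.1 q.2))
    (fun q ψ => by
      rw [abs_mul, abs_of_nonneg hL]
      exact hlip _ _ (abs_predictor_le ψ.2 _ _) (abs_predictor_le hψ₀ _ _))
    (fun q ψ ψ' => by
      rw [sub_sub_sub_cancel_right, ← mul_sub, sub_sub_sub_cancel_right, abs_mul,
        abs_of_nonneg hL]
      exact hlip _ _ (abs_predictor_le ψ.2 _ _) (abs_predictor_le ψ'.2 _ _))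
    (fun y ψ => sum_rademacherSign_mul_predictor_sub_le ψ.2 hψ₀ hL y) hl τ
  have mgf := bernoulliExpect_exp_mul_norm_signMatrix_le (m := Fin N) (n := Fin J)
    (l := l * s) (by positivity)
  simp only [Fintype.card_fin, s, mul_assoc] at mgf
  simp only [Fintype.sum_prod_type, mul_assoc] at deviation
  simpa only [centeredLogLikRatio, mul_assoc] using
    deviation.trans (mul_le_mul_of_nonneg_left mgf (exp_pos _).le)

theorem IsIFAModel.measureReal_exists_le_centeredLogLikRatio_le_one_div
    {Y : Fin N → Fin J → Ω → Fin 2} (hY : IsIFAModel P f ψ₀ Y) (hψ₀ : ψ₀ ∈ feasibleSet N J K C)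
    (hN : 0 < N) (hJ : 0 < J) (hC : 0 < C) (hL : 0 < L)
    (hlip : ∀ x x', |x| ≤ C ^ 2 → |x'| ≤ C ^ 2 →
      |logOdds f x - logOdds f x'| ≤ L * |x - x'|) :
    P.real {ω | ∃ ψ : feasibleSet N J K C,
        22 * (L * C ^ 2) * (√((N : ℝ) * J) * √((N : ℝ) + J)) ≤
          centeredLogLikRatio f ψ₀ (fun i j => Y i j ω) ψ} ≤
      1 / ((N : ℝ) + J) := by
  let s : ℝ := 2 * (L * C ^ 2) * √((N : ℝ) * J)
  have hs : 0 < s := by positivity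
  -- With this exponent the moment generating function is of the same order `exp (O(N + J))` as
  -- the cardinality of the nets, and the threshold is large enough to beat both.
  let l : ℝ := √((N : ℝ) + J) / s
  have hls : l * s = √((N : ℝ) + J) := div_mul_cancel₀ _ hs.ne'
  have hsq : √((N : ℝ) + J) ^ 2 = (N + J : ℕ) := by
    rw [sq_sqrt (by positivity), Nat.cast_add]
  have hlτ :
      l * (22 * (L * C ^ 2) * (√((N : ℝ) * J) * √((N : ℝ) + J))) = 11 * (N + J : ℕ) := by
    linear_combination (11 * √((N : ℝ) + J)) * hls + 11 * hsq
  refine (hY.measureReal_exists_le_centeredLogLikRatio_le_exp hψ₀ hL.le hlip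
    (div_nonneg (sqrt_nonneg _) hs.le : 0 ≤ l) _).trans ?_
  rw [hlτ, hls, hsq, ← Nat.cast_add]
  exact exp_neg_mul_five_pow_mul_exp_le_one_div (by omega)

theorem one_sub_le_measureReal_of_compl_subset {A B : Set Ω} {ε : ℝ} (hAB : Aᶜ ⊆ B)
    (hB : P.real B ≤ ε) :
    1 - ε ≤ P.real A := by
  have hunion := measureReal_union_le (μ := P) A Aᶜ
  rw [Set.union_compl_self, probReal_univ] at hunion
  linarith [measureReal_mono (μ := P) hAB]

theorem one_div_mul_le_mul_sqrt_div {c D F n M : ℝ} (hc : 0 < c) (hM : 0 < M) (hn : 0 ≤ n)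
    (h : c * F ≤ D * (√M * √n)) : 1 / M * F ≤ D / c * √(n / M) := by
  have hsqrt : √(n / M) * M = √M * √n := by
    rw [sqrt_div hn, div_mul_eq_mul_div, div_eq_iff (sqrt_pos.2 hM).ne']
    nth_rewrite 1 [← mul_self_sqrt hM.le]
    ring
  rw [one_div_mul_eq_div, div_le_iff₀ hM, mul_assoc, hsqrt, div_mul_eq_mul_div, le_div_iff₀ hc]
  linarith

end Deviation

theorem theorem1 (C : ℝ) (hC : 0 < C) (f : ℝ → ℝ) (hf : LinkRegular f C) :
    ∃ C₁ C₂ : ℝ, 0 < C₁ ∧ 0 < C₂ ∧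
      ∀ (K N J : ℕ), 1 ≤ N → 1 ≤ J →
      ∀ (ψstar : IFAParams N J K), ψstar ∈ feasibleSet N J K C →
      ∀ (Ω : Type*) [MeasurableSpace Ω] (P : MeasureTheory.Measure Ω)
        [MeasureTheory.IsProbabilityMeasure P] (Y : Fin N → Fin J → Ω → Fin 2),
        IsIFAModel P f ψstar Y →
        (∀ y : Fin N → Fin J → Fin 2, ∃ ψ : IFAParams N J K, IsCJMLE f C y ψ) ∧
        1 - C₁ / ((N : ℝ) + J) ≤
          P.real {ω | ∀ ψhat : IFAParams N J K, IsCJMLE f C (fun i j => Y i j ω) ψhat →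
            1 / ((N : ℝ) * J) * frobNorm (ψhat.predictor - ψstar.predictor) ^ 2 ≤
              C₂ * √(((J : ℝ) + N) / ((N : ℝ) * J))} := by
  obtain ⟨L, hL, hlip⟩ := hf.exists_logOdds_lipschitz
  obtain ⟨c, hc, hkl⟩ := hf.exists_sq_sub_le_bernoulliKL
  refine ⟨1, 22 * (L * C ^ 2) / c, one_pos, by positivity, ?_⟩
  intro K N J hN hJ ψstar hψstar Ω _ P _ Y hY
  refine ⟨hf.exists_isCJMLE ⟨ψstar, hψstar⟩, ?_⟩
  refine one_sub_le_measureReal_of_compl_subset (fun ω hω => ?_)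
    (hY.measureReal_exists_le_centeredLogLikRatio_le_one_div hψstar hN hJ hC hL hlip)
  by_contra hsmall
  refine hω fun ψhat hψhat => ?_
  rw [add_comm (J : ℝ)]
  exact one_div_mul_le_mul_sqrt_div hc (by positivity) (by positivity)
    ((hψhat.mul_frobNorm_sq_le hf hkl hψstar).trans
      (le_of_not_ge fun h => hsmall ⟨⟨ψhat, hψhat.1⟩, h⟩))
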